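/- A (finite) $4$-uniform hypergraph $H$ consists of a finite vertex set $V$ and a set of edges, each a $4$-element subset of $V$. Write $X^{(p)}$ for the set of $p$-element subsets of $X$ and $[r]=\{1,\dots,r\}$. An orientation $D$ of an $r$-uniform hypergraph assigns to each edge $e$ an ordering $D(e)=(x_1,\dots,x_r)$ of its vertices. For $I\in[r]^{(p)}$ and $A\in V^{(p)}$, the $I$-degree $d_I(A)$ is the number of edges $e$ such that, writing $D(e)=(x_1,\dots,x_r)$, one has $\{x_i : i\in I\}=A$; write $d_I(u,v)=d_I(\{u,v\})$. Classes of a partition are allowed to be empty. Theorem. There is a finite $4$-uniform hypergraph $H$ with vertex set $V$ such that (a) for every orientation of $H$ there is a pair of distinct vertices $u,v$ such that $d_I(u,v)>0$ for all $I\in[4]^{(2)}$; (b) there is a partition of $V^{(2)}$ into six sets $V_1,\dots,V_6$ such that, for every edge $e$ of $H$, the set $e^{(2)}$ is not contained in a single $V_j$. In particular, the following question of Caro and Hansberg has a negative answer for $r=4$, $p=2$: given a finite $r$-uniform hypergraph $G$ with vertex set $V$, and a partition of $V^{(p)}$ into $R=\binom{r}{p}$ sets $W_1,\dots,W_R$ such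 that no edge $e$ satisfies $e^{(p)}\subset W_i$ for any $i$, must $G$ have an orientation such that for every $A\in V^{(p)}$ there is some $I\in[r]^{(p)}$ with $d_I(A)=0$? -/

import Mathlib

/-- An `r`-uniform hypergraph on the vertex set `V`: a set of edges, each an `r`-subset of `V`. -/
structure UniformHypergraph (V : Type*) (r : ℕ) where
  edges : Finset (Finset V)
  card_eq : ∀ e ∈ edges, e.card = r

namespace UniformHypergraph

variable {V : Type*} {r : ℕ}

/-- An orientation of `H`: an ordering of the vertices of each edge.
The positions `1, …, r` are indexed by `Fin r`. -/
abbrev Orientation (H : UniformHypergraph V r) : Type _ :=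
  (e : H.edges) → (Fin r ≃ {x : V // x ∈ e.1})

/-- The `I`-degree `d_I(A)`: the number of edges `e` whose vertices in the positions labelled by
`I` are, in some order, exactly the elements of `A`. -/
noncomputable def Orientation.degree {H : UniformHypergraph V r} (D : H.Orientation)
    (I : Finset (Fin r)) (A : Finset V) : ℕ :=
  {e : H.edges | (fun i => (D e i : V)) '' (I : Set (Fin r)) = (A : Set V)}.ncard

/-- The indexed family `W` is a partition of the set `V^(p)` of all `p`-subsets of `V`
(classes may be empty), and no class contains all the `p`-subsets of an edge of `H`. -/
structure IsGoodPartition (H : UniformHypergraph V r) (p : ℕ) {ι : Type*}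
    (W : ι → Set (Finset V)) : Prop where
  disjoint : ∀ i j, i ≠ j → Disjoint (W i) (W j)
  iUnion_eq : ⋃ i, W i = {A : Finset V | A.card = p}
  not_subset : ∀ e ∈ H.edges, ∀ i, ¬ {A : Finset V | A ⊆ e ∧ A.card = p} ⊆ W i

end UniformHypergraph

/-- The assertion that the Caro–Hansberg question has a positive answer for `r` and `p`: if the
`p`-sets of vertices of a (finite) `r`-uniform hypergraph can be partitioned into `r.choose p`
classes, none of which contains all `p`-subsets of an edge, then the hypergraph has an orientation
in which every `p`-set `A` of vertices has `d_I(A) = 0` for some `p`-set `I` of positions. -/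
def CaroHansbergPositive (r p : ℕ) : Prop :=
  ∀ (V : Type) [Finite V] (H : UniformHypergraph V r),
    (∃ W : Fin (r.choose p) → Set (Finset V), H.IsGoodPartition p W) →
      ∃ D : H.Orientation, ∀ A : Finset V, A.card = p →
        ∃ I : Finset (Fin r), I.card = p ∧ D.degree I A = 0

/-! ### Ramsey's theorem for pairs -/

/-! The edges of `H` are the 4-cycles of one colour with both diagonals of another colour, in a
suitable graph `G` coloured by the six position pairs. Colouring pairs of vertices as in `G` gives
(b). If (a) fails, choose for each pair of vertices a position pair `ψ u v` that it never occupies.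
`exists_ramsey_cycle` provides `k` such that for all `i`, `j` some cycle of colour `i` with
diagonals of colour `j` has `ψ` equal to `k` of the colour. By `exists_forall_perm_fixed_pair`, `i ≠
j` can be chosen so that any ordering of this cycle puts some pair in its forbidden positions.

`G` comes from the partite construction: Hales–Jewett makes `ψ` depend only on parts and colour
(`exists_hom_canonical`), and Ramsey's theorem applied to the parts removes the dependence on parts.
-/

theorem exists_endHomogeneous (α : Type*) {κ : Type*} [LinearOrder α] [Finite κ] [Nonempty κ]
    (k : ℕ) :
    ∃ N, ∀ (f : α → α → κ) (S : Finset α), N ≤ S.card →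
      ∃ T ⊆ S, T.card = k ∧ ∃ c : α → κ, ∀ x ∈ T, ∀ y ∈ T, x < y → f x y = c x := by
  classical
  cases nonempty_fintype κ
  induction k with
  | zero =>
    exact ⟨0, fun f S _ => ⟨∅, by simp, rfl, fun _ => Classical.arbitrary κ, by simp⟩⟩
  | succ k ih =>
    obtain ⟨N, hN⟩ := ih
    refine ⟨Fintype.card κ * N + 1, fun f S hS => ?_⟩
    have hne : S.Nonempty := Finset.card_pos.mp (by omega)
    set m := S.min' hne with hm
    have hmS : m ∈ S := S.min'_mem hne
    have hcard : Fintype.card κ * N ≤ (S.erase m).card := by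
      rw [Finset.card_erase_of_mem hmS]; omega
    -- Recursing inside a popular colour class of `f m` gives `m` the constant forward colour `z`.
    obtain ⟨z, -, hz⟩ := Finset.exists_le_card_fiber_of_mul_le_card_of_maps_to
      (s := S.erase m) (t := Finset.univ) (f := f m) (n := N)
      (fun _ _ => Finset.mem_univ _) ⟨Classical.arbitrary κ, Finset.mem_univ _⟩ hcard
    obtain ⟨T, hTS, hTk, c, hc⟩ := hN f _ hz
    have hT : ∀ x ∈ T, x ≠ m ∧ x ∈ S ∧ f m x = z := fun x hx => by
      simpa [and_assoc] using hTS hx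
    refine ⟨insert m T, ?_, ?_, Function.update c m z, ?_⟩
    · exact Finset.insert_subset hmS fun x hx => (hT x hx).2.1
    · rw [Finset.card_insert_of_notMem fun h => (hT m h).1 rfl, hTk]
    · intro x hx y hy hxy
      rcases Finset.mem_insert.mp hx with rfl | hx
      · rcases Finset.mem_insert.mp hy with rfl | hy
        · exact absurd hxy (lt_irrefl _)
        · simpa using (hT y hy).2.2
      · rw [Function.update_of_ne (hT x hx).1]
        rcases Finset.mem_insert.mp hy with rfl | hy
        · exact absurd (S.min'_le x (hT x hx).2.1) (not_le.mpr hxy)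
        · exact hc x hx y hy hxy

/-- Ramsey's theorem for pairs with finitely many colours. -/
theorem exists_homogeneous (κ : Type*) [Finite κ] [Nonempty κ] (k : ℕ) :
    ∃ n, ∀ f : Fin n → Fin n → κ,
      ∃ (g : Fin k ↪o Fin n) (c : κ), ∀ a b, a < b → f (g a) (g b) = c := by
  classical
  cases nonempty_fintype κ
  -- The factor `Fintype.card κ` pays for a second pigeonhole, on the forward colour `c`.
  obtain ⟨n, hn⟩ := exists_endHomogeneous ℕ (κ := κ) (Fintype.card κ * k)
  refine ⟨n, fun f => ?_⟩
  obtain ⟨T, hTn, hT, c, hc⟩ := hn (fun x y => if h : x < n ∧ y < n then f ⟨x, h.1⟩ ⟨y, h.2⟩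
    else Classical.arbitrary κ) (Finset.range n) (by simp)
  obtain ⟨z, -, hz⟩ := Finset.exists_le_card_fiber_of_mul_le_card_of_maps_to
    (s := T) (t := Finset.univ) (f := c) (n := k)
    (fun _ _ => Finset.mem_univ _) ⟨Classical.arbitrary κ, Finset.mem_univ _⟩ hT.ge
  set g := Finset.orderEmbOfCardLe _ hz
  have hg (a : Fin k) : g a ∈ T ∧ c (g a) = z := by
    simpa using Finset.orderEmbOfCardLe_mem _ hz a
  have hlt (a : Fin k) : g a < n := Finset.mem_range.mp (hTn (hg a).1)
  refine ⟨OrderEmbedding.ofStrictMono (fun a => ⟨g a, hlt a⟩) fun a b hab => ?_, z,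
    fun a b hab => ?_⟩
  · exact g.strictMono hab
  · have := hc _ (hg a).1 _ (hg b).1 (g.strictMono hab)
    rw [dif_pos ⟨hlt a, hlt b⟩, (hg a).2] at this
    exact this

/-! ### Edge-coloured partite graphs and the partite construction -/

/-- A finite graph with edges coloured by `C` and vertices distributed over parts indexed by `P`.
Edges join different parts and are directed from the smaller part to the larger one. -/
structure PartiteGraph (P C : Type) [LT P] where
  V : Type
  finite : Finite V
  part : V → P
  adj : C → V → V → Prop
  part_lt : ∀ {c u v}, adj c u v → part u < part v
  color_unique : ∀ {c c' u v}, adj c u v → adj c' u v → c = c'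

namespace PartiteGraph

variable {P C : Type}

/-- Maps preserving the parts and the coloured edges. -/
structure Hom [LT P] (G G' : PartiteGraph P C) where
  toFun : G.V → G'.V
  part_eq : ∀ v, G'.part (toFun v) = G.part v
  adj : ∀ {c u v}, G.adj c u v → G'.adj c (toFun u) (toFun v)

section Amalgam

open Combinatorics

variable [LinearOrder P] (G : PartiteGraph P C) (p q : P) (i : C)

/-- The edges of colour `i` from part `p` to part `q`. -/
abbrev EdgeBetween : Type :=
  {e : G.V × G.V // G.adj i e.1 e.2 ∧ G.part e.1 = p ∧ G.part e.2 = q}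

/-- The vertices of the amalgam: words over the parts `p` and `q` (tagged by `false` and `true`),
and a separate copy of the vertices for each combinatorial line of edges. -/
abbrev AmalgamVertex (ι : Type) : Type :=
  Bool × (ι → G.V) ⊕ (ι → Option (G.EdgeBetween p q i)) × G.V

variable {p q i} {ι : Type}

def amalgamPart : G.AmalgamVertex p q i ι → P
  | .inl (b, _) => bif b then q else p
  | .inr (_, v) => G.part v

open Classical in
/-- The copy of `G` inside the amalgam that belongs to a combinatorial line. -/
noncomputable def lineEmb (l : Line (G.EdgeBetween p q i) ι) (v : G.V) :
    G.AmalgamVertex p q i ι :=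
  if G.part v = p then .inl (false, fun n => (l.idxFun n).elim v (·.1.1))
  else if G.part v = q then .inl (true, fun n => (l.idxFun n).elim v (·.1.2))
  else .inr (l.idxFun, v)

variable {G}

theorem lineEmb_left (l : Line (G.EdgeBetween p q i) ι) {v : G.V} (h : G.part v = p) :
    G.lineEmb l v = .inl (false, fun n => (l.idxFun n).elim v (·.1.1)) := by
  simp [lineEmb, h]

theorem lineEmb_right (hpq : p < q) (l : Line (G.EdgeBetween p q i) ι) {v : G.V}
    (h : G.part v = q) :
    G.lineEmb l v = .inl (true, fun n => (l.idxFun n).elim v (·.1.2)) := by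
  simp [lineEmb, h, hpq.ne']

theorem lineEmb_other (l : Line (G.EdgeBetween p q i) ι) {v : G.V} (hp : G.part v ≠ p)
    (hq : G.part v ≠ q) : G.lineEmb l v = .inr (l.idxFun, v) := by
  simp [lineEmb, hp, hq]

theorem amalgamPart_lineEmb (l : Line (G.EdgeBetween p q i) ι) (v : G.V) :
    G.amalgamPart (G.lineEmb l v) = G.part v := by
  unfold lineEmb
  split_ifs <;> simp [amalgamPart, *]

theorem part_eq_of_lineEmb_eq {l l' : Line (G.EdgeBetween p q i) ι} {u v : G.V}
    (h : G.lineEmb l u = G.lineEmb l' v) : G.part u = G.part v := by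
  rw [← amalgamPart_lineEmb l, h, amalgamPart_lineEmb]

/-- Outside `p` and `q` a vertex carries the tag `l.idxFun`, which determines the whole copy;
distinct copies thus meet only in the parts `p` and `q`. -/
theorem lineEmb_eq_of_other {l l' : Line (G.EdgeBetween p q i) ι} {u v : G.V}
    (hp : G.part u ≠ p) (hq : G.part u ≠ q) (h : G.lineEmb l u = G.lineEmb l' v) :
    G.lineEmb l = G.lineEmb l' := by
  have hv := part_eq_of_lineEmb_eq h
  rw [lineEmb_other l hp hq, lineEmb_other l' (hv ▸ hp) (hv ▸ hq)] at h
  have : l.idxFun = l'.idxFun := by simpa using congrArg Prod.fst (Sum.inr.inj h)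
  funext w
  simp only [lineEmb, this]

theorem lineEmb_injective (hpq : p < q) (l : Line (G.EdgeBetween p q i) ι) :
    Function.Injective (G.lineEmb l) := by
  intro u v h
  have hv := part_eq_of_lineEmb_eq h
  obtain ⟨n, hn⟩ := l.proper
  by_cases hp : G.part u = p
  · rw [lineEmb_left l hp, lineEmb_left l (hv ▸ hp)] at h
    simpa [hn] using congrFun (congrArg Prod.snd (Sum.inl.inj h)) n
  by_cases hq : G.part u = q
  · rw [lineEmb_right hpq l hq, lineEmb_right hpq l (hv ▸ hq)] at h
    simpa [hn] using congrFun (congrArg Prod.snd (Sum.inl.inj h)) n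
  · rw [lineEmb_other l hp hq, lineEmb_other l (hv ▸ hp) (hv ▸ hq)] at h
    exact congrArg Prod.snd (Sum.inr.inj h)

/-- An edge between the parts `p` and `q` that lies in two copies either has colour `i` or is the
image of the same edge in both. -/
theorem lineEmb_edge (hpq : p < q) {l l' : Line (G.EdgeBetween p q i) ι} {c : C} {u v u' v' : G.V}
    (hc : G.adj c u v) (hu : G.part u = p) (hv : G.part v = q)
    (huu : G.lineEmb l u = G.lineEmb l' u') (hvv : G.lineEmb l v = G.lineEmb l' v') :
    c = i ∨ (u = u' ∧ v = v') := by
  have hu' := part_eq_of_lineEmb_eq huu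
  have hv' := part_eq_of_lineEmb_eq hvv
  obtain ⟨n, hn⟩ := l.proper
  rw [lineEmb_left l hu, lineEmb_left l' (hu' ▸ hu)] at huu
  rw [lineEmb_right hpq l hv, lineEmb_right hpq l' (hv' ▸ hv)] at hvv
  have h1 := congrFun (congrArg Prod.snd (Sum.inl.inj huu)) n
  have h2 := congrFun (congrArg Prod.snd (Sum.inl.inj hvv)) n
  simp only [hn, Option.elim_none] at h1 h2
  cases h : l'.idxFun n with
  | none =>
    rw [h] at h1 h2
    exact .inr ⟨h1, h2⟩
  -- Here `l` is active and `l'` is fixed at `e`, so `(u, v)` is the edge `e` itself, of colour `i`.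
  | some e =>
    rw [h] at h1 h2
    simp only [Option.elim_some] at h1 h2
    subst h1 h2
    exact .inl (G.color_unique hc e.2.1)

variable (G p q i) in
/-- The amalgam of copies of `G` along all combinatorial lines of edges of colour `i` between
the parts `p` and `q`. -/
noncomputable def amalgam (hpq : p < q) (ι : Type) [Finite ι] : PartiteGraph P C where
  V := G.AmalgamVertex p q i ι
  finite := by
    have := G.finite
    infer_instance
  part := G.amalgamPart
  adj c x y := ∃ (l : Line (G.EdgeBetween p q i) ι) (u v : G.V),
    G.adj c u v ∧ G.lineEmb l u = x ∧ G.lineEmb l v = y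
  part_lt := by
    rintro c _ _ ⟨l, u, v, h, rfl, rfl⟩
    rw [amalgamPart_lineEmb, amalgamPart_lineEmb]
    exact G.part_lt h
  color_unique := by
    rintro c c' _ _ ⟨l, u, v, h, rfl, rfl⟩ ⟨l', u', v', h', hu, hv⟩
    have of_eq (hl : G.lineEmb l' = G.lineEmb l) : c = c' := by
      rw [hl] at hu hv
      obtain rfl := lineEmb_injective hpq l hu
      obtain rfl := lineEmb_injective hpq l hv
      exact G.color_unique h h'
    by_cases hup : G.part u' = p ∨ G.part u' = q
    · by_cases hvp : G.part v' = p ∨ G.part v' = q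
      · have hlt := G.part_lt h'
        have hp : G.part u' = p := by
          rcases hup with h1 | h1
          · exact h1
          · rcases hvp with h2 | h2 <;> rw [h1, h2] at hlt
            · exact absurd hlt hpq.not_gt
            · exact absurd hlt (lt_irrefl _)
        have hq : G.part v' = q := by
          rcases hvp with h2 | h2
          · rw [hp, h2] at hlt
            exact absurd hlt (lt_irrefl _)
          · exact h2
        rcases lineEmb_edge hpq h' hp hq hu hv with h1 | ⟨rfl, rfl⟩
        · rcases lineEmb_edge hpq h ((part_eq_of_lineEmb_eq hu).symm.trans hp)
            ((part_eq_of_lineEmb_eq hv).symm.trans hq) hu.symm hv.symm with h2 | ⟨rfl, rfl⟩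
          · exact h2.trans h1.symm
          · exact G.color_unique h h'
        · exact G.color_unique h h'
      · push Not at hvp
        exact of_eq (lineEmb_eq_of_other hvp.1 hvp.2 hv)
    · push Not at hup
      exact of_eq (lineEmb_eq_of_other hup.1 hup.2 hu)

variable (G p q i) in
/-- The partite lemma. -/
theorem exists_hom_constant_on (κ : Type) [Finite κ] [Nonempty κ] :
    ∃ G' : PartiteGraph P C, ∀ ψ : G'.V → G'.V → κ, ∃ (f : Hom G G') (k : κ),
      ∀ u v, G.adj i u v → G.part u = p → G.part v = q → ψ (f.toFun u) (f.toFun v) = k := by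
  by_cases hpq : p < q
  swap
  · refine ⟨G, fun ψ => ⟨⟨id, fun _ => rfl, id⟩, Classical.arbitrary κ, ?_⟩⟩
    rintro u v h rfl rfl
    exact absurd (G.part_lt h) hpq
  have := G.finite
  obtain ⟨ι, _, hι⟩ := Line.exists_mono_in_high_dimension (G.EdgeBetween p q i) κ
  refine ⟨G.amalgam p q i hpq ι, fun ψ => ?_⟩
  -- A word of edges is read as the pair of its words of left and right endpoints; along a line
  -- these pairs are the images of the `i`-edges under `lineEmb l`.
  obtain ⟨l, k, hl⟩ := hι fun w => ψ (.inl (false, fun n => (w n).1.1))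
    (.inl (true, fun n => (w n).1.2))
  refine ⟨⟨G.lineEmb l, amalgamPart_lineEmb l, fun h => ⟨l, _, _, h, rfl, rfl⟩⟩, k, ?_⟩
  intro u v h hu hv
  rw [← hl ⟨(u, v), h, hu, hv⟩]
  simp only [lineEmb_left l hu, lineEmb_right hpq l hv]
  congr 3 <;> funext n <;> rw [Line.coe_apply] <;> cases l.idxFun n <;> rfl

end Amalgam

/-- The partite construction: some `G'` contains, for every colouring of its pairs by `κ`, a copy
of `G` on which the new colour of an edge depends only on its parts and its old colour. -/
theorem exists_hom_canonical [LinearOrder P] [Finite P] [Finite C] (G : PartiteGraph P C)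
    (κ : Type) [Finite κ] [Nonempty κ] :
    ∃ G' : PartiteGraph P C, ∀ ψ : G'.V → G'.V → κ, ∃ (f : Hom G G') (k : P → P → C → κ),
      ∀ c u v, G.adj c u v → ψ (f.toFun u) (f.toFun v) = k (G.part u) (G.part v) c := by
  classical
  suffices H : ∀ S : Set (P × P × C), S.Finite → ∃ G' : PartiteGraph P C,
      ∀ ψ : G'.V → G'.V → κ, ∃ (f : Hom G G') (k : P × P × C → κ), ∀ c u v, G.adj c u v →
        (G.part u, G.part v, c) ∈ S →
        ψ (f.toFun u) (f.toFun v) = k (G.part u, G.part v, c) by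
    obtain ⟨G', h⟩ := H Set.univ Set.finite_univ
    refine ⟨G', fun ψ => ?_⟩
    obtain ⟨f, k, hk⟩ := h ψ
    exact ⟨f, fun p q c => k (p, q, c), fun c u v huv => hk c u v huv trivial⟩
  intro S hS
  induction S, hS using Set.Finite.induction_on with
  | empty =>
    exact ⟨G, fun ψ => ⟨⟨id, fun _ => rfl, id⟩, fun _ => Classical.arbitrary κ, by simp⟩⟩
  | @insert t S _ _ ih =>
    obtain ⟨G₁, h₁⟩ := ih
    obtain ⟨p, q, i⟩ := t
    obtain ⟨G₂, h₂⟩ := exists_hom_constant_on G₁ p q i κ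
    refine ⟨G₂, fun ψ => ?_⟩
    obtain ⟨f₂, z, hz⟩ := h₂ ψ
    -- Pulling `ψ` back to `G₁` settles the triples in `S`; `f₁` preserves parts and colours, so the
    -- constancy on `(p, q, i)` survives composition.
    obtain ⟨f₁, k, hk⟩ := h₁ fun x y => ψ (f₂.toFun x) (f₂.toFun y)
    refine ⟨⟨f₂.toFun ∘ f₁.toFun, fun v => (f₂.part_eq _).trans (f₁.part_eq v),
      fun h => f₂.adj (f₁.adj h)⟩, Function.update k (p, q, i) z, fun c u v huv hS => ?_⟩
    by_cases ht : (G.part u, G.part v, c) = (p, q, i)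
    · rw [ht, Function.update_self]
      simp only [Prod.mk.injEq] at ht
      obtain ⟨hp, hq, rfl⟩ := ht
      exact hz _ _ (f₁.adj huv) ((f₁.part_eq u).trans hp) ((f₁.part_eq v).trans hq)
    · rw [Function.update_of_ne ht]
      exact hk c u v huv (Set.mem_of_mem_insert_of_ne hS ht)

/-- The colour of the pair `a < b` in the pattern on `Fin 4` in which the cycle `0 1 2 3` has
colour `i` and its diagonals have colour `j`. -/
def cycleColor (i j : C) (a b : Fin 4) : C :=
  if b = a + 2 then j else i

/-- Addition in `Fin 4` is modulo 4, so being opposite is symmetric. -/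
theorem cycleColor_comm (i j : C) (a b : Fin 4) : cycleColor i j a b = cycleColor i j b a := by
  have : b = a + 2 ↔ a = b + 2 := by decide +revert
  simp only [cycleColor, this]

/-- Four vertices of `G` that carry a cycle of colour `i` with diagonals of colour `j`. -/
def IsCycle [LT P] (G : PartiteGraph P C) (i j : C) (x : Fin 4 → G.V) : Prop :=
  ∀ a b, a < b → G.adj (cycleColor i j a b) (x a) (x b)

/-- Disjoint copies of all patterns, over all sets of four parts. -/
def patterns (n : ℕ) (C : Type) [Finite C] : PartiteGraph (Fin n) C where
  V := (Fin 4 ↪o Fin n) × (C × C) × Fin 4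
  finite := by
    have : Finite (Fin 4 ↪o Fin n) := DFunLike.finite _
    infer_instance
  part v := v.1 v.2.2
  adj c u v := u.1 = v.1 ∧ u.2.1 = v.2.1 ∧ u.2.2 < v.2.2 ∧
    c = cycleColor u.2.1.1 u.2.1.2 u.2.2 v.2.2
  part_lt := by
    rintro c ⟨g, ij, a⟩ ⟨g', ij', b⟩ ⟨h, -, hab, -⟩
    obtain rfl : g = g' := h
    exact g.strictMono hab
  color_unique h h' := h.2.2.2.trans h'.2.2.2.symm

/-- An edge-coloured graph such that every colouring of its pairs is, on suitable cycles with
diagonals, a function of the given colouring. -/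
theorem exists_ramsey_cycle (C κ : Type) [Finite C] [Finite κ] [Nonempty κ] :
    ∃ (n : ℕ) (G : PartiteGraph (Fin n) C), ∀ ψ : G.V → G.V → κ, ∃ k : C → κ, ∀ i j : C,
      ∃ x : Fin 4 → G.V, G.IsCycle i j x ∧
        ∀ a b, a < b → ψ (x a) (x b) = k (cycleColor i j a b) := by
  -- A pair of parts is coloured by its entire function `C → κ`, so the same four parts serve all
  -- `i` and `j`.
  obtain ⟨n, hn⟩ := exists_homogeneous (C → κ) 4
  obtain ⟨G, hG⟩ := exists_hom_canonical (patterns n C) κ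
  refine ⟨n, G, fun ψ => ?_⟩
  obtain ⟨f, k, hk⟩ := hG ψ
  obtain ⟨g, z, hz⟩ := hn k
  refine ⟨z, fun i j => ?_⟩
  let y (a : Fin 4) : (patterns n C).V := (g, (i, j), a)
  have hy : IsCycle (patterns n C) i j y := fun a b hab => ⟨rfl, rfl, hab, rfl⟩
  exact ⟨f.toFun ∘ y, fun a b hab => f.adj (hy a b hab), fun a b hab =>
    (hk _ _ _ (hy a b hab)).trans (congrFun (hz a b hab) _)⟩

theorem IsCycle.injective [Preorder P] {G : PartiteGraph P C} {i j : C} {x : Fin 4 → G.V}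
    (h : G.IsCycle i j x) : Function.Injective x := by
  have : StrictMono (G.part ∘ x) := fun a b hab => G.part_lt (h a b hab)
  exact this.injective.of_comp

/-! ### The hypergraph of cycles with diagonals -/

open Classical in
/-- The hypergraph of vertex sets of cycles of one colour with diagonals of another colour. -/
noncomputable def cycleHypergraph [Preorder P] (G : PartiteGraph P C) :
    UniformHypergraph G.V 4 where
  edges :=
    have := G.finite
    have := Fintype.ofFinite G.V
    {e | ∃ (i j : C) (x : Fin 4 → G.V), i ≠ j ∧ G.IsCycle i j x ∧ e = Finset.univ.image x}
  card_eq e he := by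
    simp only [Finset.mem_filter, Finset.mem_univ, true_and] at he
    obtain ⟨i, j, x, -, hx, rfl⟩ := he
    rw [Finset.card_image_of_injective _ hx.injective, Finset.card_univ, Fintype.card_fin]

open Classical in
theorem mem_cycleHypergraph [Preorder P] {G : PartiteGraph P C} {e : Finset G.V} :
    e ∈ G.cycleHypergraph.edges ↔
      ∃ (i j : C) (x : Fin 4 → G.V), i ≠ j ∧ G.IsCycle i j x ∧ e = Finset.univ.image x := by
  simp [cycleHypergraph]

open Classical in
/-- The colour of an edge of `G` as a function of its vertex set. -/
noncomputable def pairColor [LT P] [Nonempty C] (G : PartiteGraph P C) (A : Finset G.V) : C :=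
  Classical.epsilon fun c => ∃ u v, A = {u, v} ∧ G.adj c u v

open Classical in
theorem pairColor_eq [Preorder P] [Nonempty C] {G : PartiteGraph P C} {c : C} {u v : G.V}
    (h : G.adj c u v) : G.pairColor {u, v} = c := by
  obtain ⟨u', v', huv, h'⟩ := Classical.epsilon_spec
    (p := fun c => ∃ u' v', ({u, v} : Finset G.V) = {u', v'} ∧ G.adj c u' v') ⟨c, u, v, rfl, h⟩
  have huv : s(u, v) = s(u', v') := by
    rw [← Finset.coe_inj] at huv
    simp only [Finset.coe_insert, Finset.coe_singleton, Set.pair_eq_pair_iff] at huv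
    simpa using huv
  rcases Sym2.eq_iff.mp huv with ⟨rfl, rfl⟩ | ⟨rfl, rfl⟩
  · exact G.color_unique h' h
  · exact absurd (G.part_lt h) (G.part_lt h').not_gt

theorem exists_isGoodPartition [Preorder P] [Nonempty C] (G : PartiteGraph P C) {ι : Type*}
    (e : ι ≃ C) : ∃ W : ι → Set (Finset G.V), G.cycleHypergraph.IsGoodPartition 2 W := by
  classical
  refine ⟨fun t => {A | A.card = 2 ∧ G.pairColor A = e t}, ?_, ?_, ?_⟩
  · intro s t hst
    refine Set.disjoint_left.mpr fun A hs ht => hst (e.injective ?_)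
    exact hs.2.symm.trans ht.2
  · ext A
    simp only [Set.mem_iUnion, Set.mem_ofPred_eq, exists_and_left, and_iff_left_iff_imp]
    exact fun _ => ⟨e.symm (G.pairColor A), by simp⟩
  · intro E hE t hsub
    obtain ⟨i, j, x, hij, hx, rfl⟩ := mem_cycleHypergraph.mp hE
    have key (a b : Fin 4) (hab : a < b) : cycleColor i j a b = e t := by
      rw [← pairColor_eq (hx a b hab)]
      refine (hsub ⟨?_, Finset.card_pair (hx.injective.ne hab.ne)⟩).2
      simp [Finset.insert_subset_iff]
    exact hij ((key 0 1 (by decide)).trans (key 0 2 (by decide)).symm)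

end PartiteGraph

/-- The two-element sets of positions in an ordered quadruple. -/
abbrev PositionPair : Type := {I : Finset (Fin 4) // I.card = 2}

/-- For every recolouring `k` of the six colours, some cycle of one colour with diagonals of
another colour has a pair at its own colour in each ordering of its vertices. -/
theorem exists_forall_perm_fixed_pair (k : PositionPair → PositionPair) :
    ∃ i j, i ≠ j ∧ ∀ σ : Equiv.Perm (Fin 4), ∃ a b, a ≠ b ∧
      (k (PartiteGraph.cycleColor i j (σ a) (σ b))).1 = {a, b} := by
  by_cases hk : Function.Injective k
  · obtain ⟨i, hi⟩ := (Finite.injective_iff_surjective.mp hk) ⟨{0, 1}, rfl⟩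
    obtain ⟨j, hj⟩ := (Finite.injective_iff_surjective.mp hk) ⟨{2, 3}, rfl⟩
    refine ⟨i, j, ?_, fun σ => ?_⟩
    · rintro rfl
      exact absurd (hi.symm.trans hj) (by decide)
    -- If positions 0 and 1 hold a diagonal, positions 2 and 3 hold the other one, of colour `j`;
    -- otherwise positions 0 and 1 hold a cycle edge, of colour `i`.
    · by_cases h : σ 1 = σ 0 + 2
      · have h' : σ 3 = σ 2 + 2 := by
          have h02 : σ 0 ≠ σ 2 := σ.injective.ne (by decide)
          have h03 : σ 0 ≠ σ 3 := σ.injective.ne (by decide)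
          have h12 : σ 1 ≠ σ 2 := σ.injective.ne (by decide)
          have h13 : σ 1 ≠ σ 3 := σ.injective.ne (by decide)
          have h23 : σ 2 ≠ σ 3 := σ.injective.ne (by decide)
          omega
        exact ⟨2, 3, by decide, by rw [PartiteGraph.cycleColor, if_pos h', hj]⟩
      · exact ⟨0, 1, by decide, by rw [PartiteGraph.cycleColor, if_neg h, hi]⟩
  · simp only [Function.Injective, not_forall] at hk
    -- Both colours forbid the same positions, which every ordering fills with some pair.
    obtain ⟨i, j, hij, hne⟩ := hk
    obtain ⟨a, b, hab, hI⟩ := Finset.card_eq_two.mp (k i).2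
    refine ⟨i, j, hne, fun σ => ⟨a, b, hab, ?_⟩⟩
    rw [PartiteGraph.cycleColor]
    split_ifs
    · rw [← hij, hI]
    · exact hI

theorem UniformHypergraph.Orientation.degree_pair_pos {V : Type*} {r : ℕ}
    {H : UniformHypergraph V r} (D : H.Orientation) (e : H.edges) (a b : Fin r) [DecidableEq V] :
    0 < D.degree {a, b} {(D e a : V), (D e b : V)} := by
  refine (Set.ncard_pos (Set.toFinite _)).mpr ⟨e, ?_⟩
  simp [Set.image_pair]

theorem PartiteGraph.exists_pair_degree_pos {P : Type} [Preorder P]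
    {G : PartiteGraph P PositionPair} [DecidableEq G.V]
    (hG : ∀ ψ : G.V → G.V → PositionPair, ∃ k : PositionPair → PositionPair, ∀ i j,
      ∃ x : Fin 4 → G.V, G.IsCycle i j x ∧ ∀ a b, a < b → ψ (x a) (x b) = k (cycleColor i j a b))
    (D : G.cycleHypergraph.Orientation) :
    ∃ u v : G.V, u ≠ v ∧ ∀ I : Finset (Fin 4), I.card = 2 → 0 < D.degree I {u, v} := by
  by_contra! hD
  have hD' (u v : G.V) : ∃ I : PositionPair, u ≠ v → D.degree I.1 {u, v} = 0 := by
    by_cases huv : u = v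
    · exact ⟨⟨{0, 1}, rfl⟩, fun h => absurd huv h⟩
    · obtain ⟨I, hI, h⟩ := hD u v huv
      exact ⟨⟨I, hI⟩, fun _ => Nat.le_zero.mp h⟩
  choose ψ hψ using hD'
  obtain ⟨k, hk⟩ := hG ψ
  obtain ⟨i, j, hij, hσ⟩ := exists_forall_perm_fixed_pair k
  obtain ⟨x, hx, hxk⟩ := hk i j
  have hzero (s t : Fin 4) (hst : s ≠ t) :
      D.degree (k (cycleColor i j s t)).1 {x s, x t} = 0 := by
    rcases lt_or_gt_of_ne hst with h | h
    · rw [← hxk s t h]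
      exact hψ _ _ (hx.injective.ne hst)
    · rw [cycleColor_comm, Finset.pair_comm, ← hxk t s h]
      exact hψ _ _ (hx.injective.ne hst.symm)
  classical
  let e : G.cycleHypergraph.edges :=
    ⟨Finset.univ.image x, mem_cycleHypergraph.mpr ⟨i, j, x, hij, hx, by congr!⟩⟩
  have hmem (a : Fin 4) : ∃ s, x s = (D e a : G.V) := by
    obtain ⟨s, -, hs⟩ := Finset.mem_image.mp (D e a).2
    exact ⟨s, hs⟩
  -- `s` records the order in which `D e` lists the vertices of the cycle.
  choose s hs using hmem
  have hinj : Function.Injective s := fun a b hab => by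
    refine (D e).injective (Subtype.ext ?_)
    rw [← hs a, ← hs b, hab]
  obtain ⟨a, b, hab, h⟩ := hσ (Equiv.ofBijective s (Finite.injective_iff_bijective.mp hinj))
  have hpos := D.degree_pair_pos e a b
  rw [← hs a, ← hs b, ← h] at hpos
  exact hpos.ne' (hzero (s a) (s b) (hinj.ne hab))

theorem mainTheorem1 :
    (∃ (V : Type) (_ : Fintype V) (_ : DecidableEq V) (H : UniformHypergraph V 4),
      (∀ D : H.Orientation, ∃ u v : V, u ≠ v ∧
        ∀ I : Finset (Fin 4), I.card = 2 → 0 < D.degree I {u, v}) ∧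
      (∃ W : Fin 6 → Set (Finset V), H.IsGoodPartition 2 W)) ∧
    ¬ CaroHansbergPositive 4 2 := by
  have hcard : Fintype.card PositionPair = 6 := by decide
  have hne : Nonempty PositionPair := ⟨⟨{0, 1}, rfl⟩⟩
  refine and_iff_left_of_imp ?_ |>.mpr ?_
  · rintro ⟨V, _, _, H, hD, hW⟩ hpos
    obtain ⟨D, hA⟩ := hpos V H hW
    obtain ⟨u, v, huv, hdeg⟩ := hD D
    obtain ⟨I, hI, h0⟩ := hA {u, v} (Finset.card_pair huv)
    exact (hdeg I hI).ne' h0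
  · obtain ⟨n, G, hG⟩ := PartiteGraph.exists_ramsey_cycle PositionPair PositionPair
    have := G.finite
    classical
    exact ⟨G.V, Fintype.ofFinite _, Classical.decEq _, G.cycleHypergraph,
      fun D => PartiteGraph.exists_pair_degree_pos hG D,
      G.exists_isGoodPartition (Fintype.equivFinOfCardEq hcard).symm⟩
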